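/- Let $G$ be a group with a Garside structure $(G,P,\Delta)$: $P\subseteq G$ is a submonoid with $P\cap P^{-1}=\{1\}$ and $\Delta\in P$, such that (i) the partial order $a\preccurlyeq b\Leftrightarrow a^{-1}b\in P$ is a lattice order on $G$, with greatest common divisor denoted $\wedge$; (ii) the set $[1,\Delta]=\{a\in G : 1\preccurlyeq a\preccurlyeq\Delta\}$ of simple elements generates $G$; (iii) $\Delta^{-1}P\Delta=P$; (iv) for every $x\in P\setminus\{1\}$, the number of factors in the expressions of $x$ as a product of elements of $P\setminus\{1\}$ is bounded. Suppose that the structure is of finite type, i.e. that $[1,\Delta]$ is finite. Every $x\in G$ can be written as $x=\Delta^p x_1\cdots x_r$ with $p\in\mathbb Z$, $r\ge 0$, $x_i\in[1,\Delta]\setminus\{1,\Delta\}$ for all $i$, and $(x_i^{-1}\Delta)\wedge x_{i+1}=1$ for $1\le i<r$ (left normal form); put $\inf(x)=p$ (this exponent is unique unless $G$ is trivial, in which case its choice is irrelevant). Let $\iota(x)=x\Delta^{-\inf(x)}\wedge\Delta$ be the initial factor, $\mathfrak p(x)=\iota(x)\wedge\iota(x^{-1})$ the preferred prefix, and $\mathfrak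 s(x)=\mathfrak p(x)^{-1}\,x\,\mathfrak p(x)$ the cyclic sliding of $x$. Call $x$ rigid if $\mathfrak p(x)=1$, and let ${\rm SC}(x)$, the set of sliding circuits of $x$, be the set of all conjugates $y$ of $x$ in $G$ such that $\mathfrak s^m(y)=y$ for some $m\ge 1$. Then, for every $x\in G$ that is conjugate to a rigid element, ${\rm SC}(x)$ is exactly the set of rigid conjugates of $x$. -/

import Mathlib

/-- Prefix order on a group `G` with respect to a submonoid `P`:
`a ≼ b` if and only if `a⁻¹ * b ∈ P`. -/
def PrefixLE {G : Type*} [Group G] (P : Submonoid G) (a b : G) : Prop :=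
  a⁻¹ * b ∈ P

/-- A Garside structure `(G, P, Δ)` on a group `G`. -/
structure GarsideStructure (G : Type*) [Group G] where
  /-- the monoid of positive elements -/
  P : Submonoid G
  /-- the Garside element -/
  Δ : G
  Δ_mem : Δ ∈ P
  /-- `P ∩ P⁻¹ = {1}` -/
  eq_one_of_mem_of_inv_mem : ∀ a : G, a ∈ P → a⁻¹ ∈ P → a = 1
  /-- greatest common divisors exist (uniqueness is antisymmetry of `≼`) -/
  exists_gcd : ∀ a b : G, ∃ d : G, PrefixLE P d a ∧ PrefixLE P d b ∧
    ∀ c : G, PrefixLE P c a → PrefixLE P c b → PrefixLE P c d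
  /-- least common multiples exist (uniqueness is antisymmetry of `≼`) -/
  exists_lcm : ∀ a b : G, ∃ m : G, PrefixLE P a m ∧ PrefixLE P b m ∧
    ∀ c : G, PrefixLE P a c → PrefixLE P b c → PrefixLE P m c
  /-- the simple elements generate `G` as a group -/
  closure_simple : Subgroup.closure {a : G | PrefixLE P 1 a ∧ PrefixLE P a Δ} = ⊤
  /-- `Δ⁻¹ P Δ = P` -/
  conj_mem_iff : ∀ a : G, Δ⁻¹ * a * Δ ∈ P ↔ a ∈ P
  /-- the length of a factorisation of `x` into nontrivial positive elements is bounded -/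
  bddAbove_length : ∀ x : G, x ∈ P → x ≠ 1 →
    BddAbove {k : ℕ | ∃ l : List G, l.length = k ∧ (∀ a ∈ l, a ∈ P ∧ a ≠ 1) ∧ l.prod = x}

namespace GarsideStructure

variable {G : Type*} [Group G] (S : GarsideStructure G)

/-- The prefix order `a ≼ b` of a Garside structure. -/
def le (a b : G) : Prop := PrefixLE S.P a b

/-- The set `[1, Δ]` of simple elements. -/
def simples : Set G := {a | S.le 1 a ∧ S.le a S.Δ}

/-- The structure is of finite type if there are only finitely many simple elements. -/
def FiniteType : Prop := S.simples.Finite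

/-- The greatest common divisor `a ∧ b` with respect to `≼`. -/
noncomputable def meet (a b : G) : G := Classical.choose (S.exists_gcd a b)

/-- For simple elements `a` and `b`, the product `a · b` is left weighted:
`∂(a) ∧ b = 1`, where `∂(a) = a⁻¹ Δ`. -/
def LeftWeighted (a b : G) : Prop := S.meet (a⁻¹ * S.Δ) b = 1

/-- `x = Δ ^ p * x₁ * ⋯ * xᵣ` with `l = [x₁, …, xᵣ]` is a left normal form. -/
def IsLeftNormalForm (x : G) (p : ℤ) (l : List G) : Prop :=
  x = S.Δ ^ p * l.prod ∧ (∀ a ∈ l, a ∈ S.simples ∧ a ≠ 1 ∧ a ≠ S.Δ) ∧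
    l.IsChain S.LeftWeighted

theorem meet_le_left (a b : G) : S.le (S.meet a b) a :=
  (Classical.choose_spec (S.exists_gcd a b)).1

theorem meet_le_right (a b : G) : S.le (S.meet a b) b :=
  (Classical.choose_spec (S.exists_gcd a b)).2.1

theorem le_meet {a b c : G} (ha : S.le c a) (hb : S.le c b) : S.le c (S.meet a b) :=
  (Classical.choose_spec (S.exists_gcd a b)).2.2 c ha hb

theorem le_refl (a : G) : S.le a a := by
  simp [le, PrefixLE]

theorem le_trans {a b c : G} (h₁ : S.le a b) (h₂ : S.le b c) : S.le a c := by
  have h := S.P.mul_mem h₁ h₂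
  simpa [le, PrefixLE, mul_assoc] using h

theorem le_antisymm {a b : G} (h₁ : S.le a b) (h₂ : S.le b a) : a = b := by
  have h := S.eq_one_of_mem_of_inv_mem _ h₁ (by simpa [le, PrefixLE] using h₂)
  exact inv_mul_eq_one.mp h

theorem mul_le_mul_left_iff (c a b : G) : S.le (c * a) (c * b) ↔ S.le a b := by
  simp [le, PrefixLE, mul_assoc]

theorem mul_le_iff (c a b : G) : S.le (c * a) b ↔ S.le a (c⁻¹ * b) := by
  simp [le, PrefixLE, mul_assoc]

theorem le_mul_Δ_iff (a b : G) : S.le (a * S.Δ) (b * S.Δ) ↔ S.le a b := by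
  have h := S.conj_mem_iff (a⁻¹ * b)
  simpa [le, PrefixLE, mul_assoc] using h

theorem le_mul_pow_iff (a b : G) (n : ℕ) :
    S.le (a * S.Δ ^ n) (b * S.Δ ^ n) ↔ S.le a b := by
  induction n with
  | zero => simp
  | succ n ih => rw [pow_succ, ← mul_assoc, ← mul_assoc, le_mul_Δ_iff, ih]

theorem one_le_Δ_pow (n : ℕ) : S.le 1 (S.Δ ^ n) := by
  simpa [le, PrefixLE] using S.P.pow_mem S.Δ_mem n

theorem Δ_le_mul_Δ {a : G} (ha : S.le 1 a) : S.le S.Δ (a * S.Δ) := by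
  simpa using (S.le_mul_Δ_iff 1 a).2 ha

theorem exists_bounds (x : G) :
    ∃ n : ℕ, S.le (S.Δ ^ (-(n : ℤ))) x ∧ S.le x (S.Δ ^ n) := by
  have inv_bound : ∀ (y : G) (n : ℕ),
      S.le (S.Δ ^ (-(n : ℤ))) y ↔ S.le y⁻¹ (S.Δ ^ n) := by
    intro y n
    have h := S.le_mul_pow_iff (S.Δ ^ (-(n : ℤ))) y n
    rw [← h]
    simp [le, PrefixLE]
  have mul_bound : ∀ (y z : G) (n m : ℕ), S.le y (S.Δ ^ n) → S.le z (S.Δ ^ m) →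
      S.le (y * z) (S.Δ ^ (n + m)) := by
    intro y z n m hy hz
    refine S.le_trans ((S.mul_le_mul_left_iff y _ _).2 hz) ?_
    rw [pow_add, S.le_mul_pow_iff]
    exact hy
  have mono : ∀ (y : G) (n m : ℕ), S.le y (S.Δ ^ n) → S.le y (S.Δ ^ (n + m)) := by
    intro y n m hy
    simpa using mul_bound y 1 n m hy (S.one_le_Δ_pow m)
  have key : ∀ y ∈ Subgroup.closure {a : G | PrefixLE S.P 1 a ∧ PrefixLE S.P a S.Δ},
      ∃ n : ℕ, S.le y⁻¹ (S.Δ ^ n) ∧ S.le y (S.Δ ^ n) := by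
    intro y hy
    induction hy using Subgroup.closure_induction with
    | mem s hs =>
      refine ⟨1, ?_, by rw [pow_one]; exact hs.2⟩
      rw [← inv_bound]
      refine S.le_trans (b := 1) ?_ hs.1
      rw [inv_bound]
      simpa using S.one_le_Δ_pow 1
    | one => exact ⟨0, by simpa using S.le_refl 1, by simpa using S.le_refl 1⟩
    | mul y z _ _ hy hz =>
      obtain ⟨n, h1, h2⟩ := hy
      obtain ⟨m, h3, h4⟩ := hz
      refine ⟨n + m, ?_, mul_bound _ _ _ _ h2 h4⟩
      rw [mul_inv_rev, add_comm]
      exact mul_bound _ _ _ _ h3 h1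
    | inv y _ hy =>
      obtain ⟨n, h1, h2⟩ := hy
      exact ⟨n, by simpa using h2, h1⟩
  obtain ⟨n, h1, h2⟩ := key x (by rw [S.closure_simple]; trivial)
  exact ⟨n, (inv_bound x n).2 h1, h2⟩

theorem le_prod_of_forall (a : G) (l : List G) (h : ∀ b ∈ l, b ∈ S.simples) :
    S.le a (a * l.prod) := by
  have : l.prod ∈ S.P := S.P.list_prod_mem fun b hb => by
    simpa [le, PrefixLE] using (h b hb).1
  simpa [le, PrefixLE] using this

theorem exists_factorisation (m : ℕ) (y : G) (h1 : S.le 1 y) (hm : S.le y (S.Δ ^ m))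
    (hΔ : ¬ S.le S.Δ y) :
    ∃ l : List G, l.prod = y ∧ (∀ a ∈ l, a ∈ S.simples ∧ a ≠ 1 ∧ a ≠ S.Δ) ∧
      l.IsChain S.LeftWeighted := by
  induction m generalizing y with
  | zero =>
    refine ⟨[], ?_, by simp, by simp⟩
    simpa using S.le_antisymm h1 (by simpa using hm)
  | succ m ih =>
    set a := S.meet y S.Δ with ha
    have h1a : S.le 1 a := S.le_meet h1 (by simpa using S.one_le_Δ_pow 1)
    have hay : S.le a y := S.meet_le_left y S.Δ
    have haΔ : S.le a S.Δ := S.meet_le_right y S.Δ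
    have hy : S.le (a⁻¹ * y) (S.Δ ^ m) := by
      rw [← S.mul_le_mul_left_iff a]
      rw [← mul_assoc, mul_inv_cancel, one_mul, ← inv_mul_cancel_right y (S.Δ ^ m),
        S.le_mul_pow_iff]
      refine S.le_meet ?_ ?_
      · have h := S.P.pow_mem S.Δ_mem m
        have h2 := (S.le_mul_pow_iff (y * (S.Δ ^ m)⁻¹) y m).1
          (by simpa [le, PrefixLE] using h)
        exact h2
      · rw [← S.le_mul_pow_iff _ _ m]
        simpa [pow_succ'] using hm
    have hΔ2 : ¬ S.le S.Δ (a⁻¹ * y) := by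
      intro h
      rw [← S.mul_le_iff] at h
      exact hΔ (S.le_trans (S.Δ_le_mul_Δ h1a) h)
    have h1y : S.le 1 (a⁻¹ * y) := by
      rw [← S.mul_le_iff, mul_one]; exact hay
    by_cases ha1 : a = 1
    · exact ih y h1 (by simpa [ha1] using hy) hΔ
    obtain ⟨l, hl, hs, hc⟩ := ih _ h1y hy hΔ2
    refine ⟨a :: l, by simp [hl], ?_, ?_⟩
    · intro b hb
      rcases List.mem_cons.1 hb with rfl | hb
      · exact ⟨⟨h1a, haΔ⟩, ha1, fun h => hΔ (h ▸ hay)⟩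
      · exact hs b hb
    · rw [List.isChain_cons]
      refine ⟨?_, hc⟩
      intro b hb
      obtain ⟨t, rfl⟩ : ∃ t, l = b :: t := by
        cases l with
        | nil => simp at hb
        | cons c t => exact ⟨t, by simp at hb; rw [hb]⟩
      have hby : S.le b (a⁻¹ * y) := by
        rw [← hl, List.prod_cons]
        exact S.le_prod_of_forall b t fun c hc => (hs c (by simp [hc])).1
      refine S.le_antisymm ?_ ?_
      · have h2 : S.le (a * S.meet (a⁻¹ * S.Δ) b) a := by
          refine S.le_meet ?_ ?_
          · rw [S.mul_le_iff]; exact S.le_trans (S.meet_le_right _ _) hby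
          · rw [S.mul_le_iff]; exact S.meet_le_left _ _
        rw [S.mul_le_iff] at h2
        simpa using h2
      · refine S.le_meet ?_ (hs b (by simp)).1.1
        rw [← S.mul_le_iff, mul_one]; exact haΔ

theorem Δ_zpow_le_iff (hΔ : S.Δ ≠ 1) (p q : ℤ) :
    S.le (S.Δ ^ p) (S.Δ ^ q) ↔ p ≤ q := by
  have e : S.le (S.Δ ^ p) (S.Δ ^ q) ↔ S.Δ ^ (q - p) ∈ S.P := by
    rw [le, PrefixLE, ← zpow_neg, ← zpow_add, neg_add_eq_sub]
  rw [e]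
  constructor
  · intro h
    by_contra! hlt
    obtain ⟨n, hn⟩ : ∃ n : ℕ, q - p = -((n : ℤ) + 1) := ⟨(p - q - 1).toNat, by omega⟩
    apply hΔ
    apply S.eq_one_of_mem_of_inv_mem _ S.Δ_mem
    have h2 := S.P.mul_mem (S.P.pow_mem S.Δ_mem n) h
    rw [hn, ← zpow_natCast, ← zpow_add] at h2
    simpa using h2
  · intro h
    obtain ⟨n, hn⟩ : ∃ n : ℕ, q - p = n := ⟨(q - p).toNat, by omega⟩
    rw [hn, zpow_natCast]
    exact S.P.pow_mem S.Δ_mem n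

/-- Every element has a left normal form. -/
theorem exists_isLeftNormalForm (x : G) : ∃ (p : ℤ) (l : List G), S.IsLeftNormalForm x p l := by
  obtain ⟨n, h1, h2⟩ := S.exists_bounds x
  by_cases hΔ : S.Δ = 1
  · refine ⟨0, [], ?_, by simp, by simp⟩
    simp only [hΔ, one_zpow, one_pow] at h1 h2
    simpa using S.le_antisymm h2 h1
  obtain ⟨p, hp, hmax⟩ := Int.exists_greatest_of_bdd (P := fun q : ℤ => S.le (S.Δ ^ q) x)
    ⟨n, fun q hq => by
      rw [← S.Δ_zpow_le_iff hΔ, zpow_natCast]; exact S.le_trans hq h2⟩ ⟨_, h1⟩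
  obtain ⟨m, -, hm⟩ := S.exists_bounds ((S.Δ ^ p)⁻¹ * x)
  obtain ⟨l, hl, hs, hc⟩ := S.exists_factorisation m ((S.Δ ^ p)⁻¹ * x)
    (by rw [← S.mul_le_iff, mul_one]; exact hp) hm (by
      intro h
      rw [← S.mul_le_iff, ← zpow_add_one] at h
      have := hmax _ h
      omega)
  exact ⟨p, l, by simp [hl], hs, hc⟩

/-- The exponent in a left normal form is the largest `q` with `Δ ^ q ≼ x`. -/
theorem IsLeftNormalForm.isGreatest {S : GarsideStructure G} {x : G} {p : ℤ} {l : List G}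
    (h : S.IsLeftNormalForm x p l) (hΔ : S.Δ ≠ 1) :
    IsGreatest {q : ℤ | S.le (S.Δ ^ q) x} p := by
  have head : ∀ (l : List G) (a c : G), (∀ b ∈ a :: l, b ∈ S.simples) →
      (a :: l).IsChain S.LeftWeighted → S.le c S.Δ → S.le c (a :: l).prod → S.le c a := by
    intro l
    induction l with
    | nil => intro a c _ _ _ h; simpa using h
    | cons b t ih =>
      intro a c hs hc hcΔ hcp
      have e : a * (a⁻¹ * c) = c := by simp
      have h3 : S.le (a⁻¹ * c) b := by
        refine ih b (a⁻¹ * c) (fun d hd => hs d (List.mem_cons_of_mem _ hd))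
          (List.isChain_cons_cons.1 hc).2 ?_ ?_
        · rw [← S.mul_le_mul_left_iff a, e]
          exact S.le_trans hcΔ (S.Δ_le_mul_Δ (hs a (by simp)).1)
        · rw [← S.mul_le_mul_left_iff a, e]
          simpa using hcp
      have h4 : S.le (a⁻¹ * c) (a⁻¹ * S.Δ) := (S.mul_le_mul_left_iff _ _ _).2 hcΔ
      have h5 := S.le_meet h4 h3
      have hw : S.meet (a⁻¹ * S.Δ) b = 1 := (List.isChain_cons_cons.1 hc).1
      rw [hw, ← S.mul_le_mul_left_iff a, e, mul_one] at h5
      exact h5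
  obtain ⟨hx, hs, hc⟩ := h
  refine ⟨?_, ?_⟩
  · show S.le (S.Δ ^ p) x
    rw [hx]
    exact S.le_prod_of_forall _ l fun b hb => (hs b hb).1
  · intro q hq
    by_contra! hlt
    have h6 : S.le (S.Δ ^ (p + 1)) x :=
      S.le_trans ((S.Δ_zpow_le_iff hΔ _ _).2 (by omega)) hq
    rw [zpow_add_one, hx, S.mul_le_mul_left_iff] at h6
    cases l with
    | nil =>
      refine hΔ (S.le_antisymm (by simpa using h6) ?_)
      simpa using S.one_le_Δ_pow 1
    | cons a t =>
      have h7 := head t a S.Δ (fun b hb => (hs b hb).1) hc (S.le_refl _) h6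
      exact (hs a (by simp)).2.2 (S.le_antisymm (hs a (by simp)).1.2 h7)

/-- The infimum `inf(x)`: the exponent of `Δ` in the left normal form of `x`. (If `Δ = 1`, then
`G` is trivial and the exponent, which is not unique in this case, plays no role.) -/
noncomputable def infimum (x : G) : ℤ := Classical.choose (S.exists_isLeftNormalForm x)

theorem infimum_spec (x : G) : ∃ l : List G, S.IsLeftNormalForm x (S.infimum x) l :=
  Classical.choose_spec (S.exists_isLeftNormalForm x)

/-- The initial factor `ι(x) = x Δ^{-inf(x)} ∧ Δ`. -/
noncomputable def initialFactor (x : G) : G :=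
  S.meet (x * S.Δ ^ (-S.infimum x)) S.Δ

/-- The preferred prefix `𝔭(x) = ι(x) ∧ ι(x⁻¹)`. -/
noncomputable def preferredPrefix (x : G) : G :=
  S.meet (S.initialFactor x) (S.initialFactor x⁻¹)

/-- Cyclic sliding `𝔰(x) = 𝔭(x)⁻¹ x 𝔭(x)`. -/
noncomputable def cyclicSliding (x : G) : G :=
  (S.preferredPrefix x)⁻¹ * x * S.preferredPrefix x

/-- `x` is rigid if its preferred prefix is trivial. -/
def IsRigid (x : G) : Prop := S.preferredPrefix x = 1

/-- The set of sliding circuits `SC(x)`: all conjugates `y` of `x` with `𝔰^m(y) = y` for some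
`m ≥ 1`. -/
def slidingCircuits (x : G) : Set G :=
  {y | IsConj x y ∧ ∃ m : ℕ, 1 ≤ m ∧ S.cyclicSliding^[m] y = y}

end GarsideStructure

/-!
Every conjugate of a rigid element `z` is carried to a rigid element by finitely many cyclic
slidings, and rigid elements are fixed by cyclic sliding. Hence a sliding circuit that contains a
conjugate of `z` consists of one rigid element, and conversely every rigid element is a sliding
circuit of length one.

The argument works with truncated versions of the initial factor and the preferred prefix, in
which `inf(y)` and `inf(y⁻¹)` are replaced by fixed integers `q` and `t`. The elements
`g * ι_q(g⁻¹ y g)` and `g * 𝔭_{q,t}(g⁻¹ y g)` (`cycleStep` and `slideStep`) are meets of translates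
`y ^ i * g * Δ ^ j`. As functions of `g`, they are monotone, commute with each other, and commute
with right multiplication by powers of `Δ`. This has three consequences.

* Truncated cycling raises the infimum as long as some conjugate has a larger one
  (`exists_iterate_truncCycling`): a positive conjugator from the larger element loses length
  in each step.
* If truncated cycling raises the infimum in `n + 1` steps from `y`, it does so in `n` steps from
  the sliding of `y` (`zpow_le_truncSliding`), so cyclic sliding raises the infimum as well
  (`exists_iterate_cyclicSliding`). The same holds for `y⁻¹`, because `𝔰(y⁻¹) = 𝔰(y)⁻¹`. In
  particular rigid elements have maximal infimum and minimal supremum in their conjugacy class,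
  and cyclic sliding attains these values.
* Once the values are attained, every positive `α` with `α⁻¹ y α` rigid satisfies `𝔭(y) ≼ α`, by
  monotonicity. Sliding replaces `α` by `𝔭(y)⁻¹ α`, which is shorter unless `y` is rigid
  (`exists_iterate_isRigid_of_slideStep_eq`).
-/

namespace GarsideStructure

variable {G : Type*} [Group G] (S : GarsideStructure G)

/-! ### Meets and translations -/

theorem le_meet_iff {a b c : G} : S.le c (S.meet a b) ↔ S.le c a ∧ S.le c b :=
  ⟨fun h => ⟨S.le_trans h (S.meet_le_left a b), S.le_trans h (S.meet_le_right a b)⟩,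
    fun h => S.le_meet h.1 h.2⟩

theorem eq_of_forall_le_iff {a b : G} (h : ∀ c, S.le c a ↔ S.le c b) : a = b :=
  S.le_antisymm ((h a).1 (S.le_refl a)) ((h b).2 (S.le_refl b))

theorem meet_comm (a b : G) : S.meet a b = S.meet b a :=
  S.eq_of_forall_le_iff fun c => by simp only [le_meet_iff, and_comm]

theorem mul_meet (g a b : G) : g * S.meet a b = S.meet (g * a) (g * b) :=
  S.eq_of_forall_le_iff fun c => by
    have e : c = g * (g⁻¹ * c) := by simp
    rw [e]
    simp only [le_meet_iff, mul_le_mul_left_iff]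

theorem le_mul_zpow_iff (a b : G) (k : ℤ) : S.le (a * S.Δ ^ k) (b * S.Δ ^ k) ↔ S.le a b := by
  obtain ⟨n, rfl | rfl⟩ := k.eq_nat_or_neg
  · simpa using S.le_mul_pow_iff a b n
  · rw [← S.le_mul_pow_iff (a * S.Δ ^ (-(n : ℤ))) _ n]
    simp [mul_assoc]

theorem meet_mul_zpow (a b : G) (k : ℤ) :
    S.meet a b * S.Δ ^ k = S.meet (a * S.Δ ^ k) (b * S.Δ ^ k) :=
  S.eq_of_forall_le_iff fun c => by
    have e : c = c * S.Δ ^ (-k) * S.Δ ^ k := by simp [mul_assoc]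
    rw [e]
    simp only [le_meet_iff, le_mul_zpow_iff]

theorem meet_mul_Δ (a b : G) : S.meet a b * S.Δ = S.meet (a * S.Δ) (b * S.Δ) := by
  simpa using S.meet_mul_zpow a b 1

theorem one_le_iff (a : G) : S.le 1 a ↔ a ∈ S.P := by
  simp [le, PrefixLE]

theorem one_le_Δ : S.le 1 S.Δ := (S.one_le_iff _).2 S.Δ_mem

theorem zpow_le_zpow {p q : ℤ} (h : p ≤ q) : S.le (S.Δ ^ p) (S.Δ ^ q) := by
  obtain ⟨n, rfl⟩ := Int.le.dest h
  rw [zpow_add, zpow_natCast]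
  simpa using (S.mul_le_mul_left_iff (S.Δ ^ p) 1 (S.Δ ^ n)).2 (S.one_le_Δ_pow n)

/-! ### Length of positive elements -/

/-- The lengths of the factorisations of `x` into nontrivial positive elements. -/
def factorLengths (x : G) : Set ℕ :=
  {k : ℕ | ∃ l : List G, l.length = k ∧ (∀ a ∈ l, a ∈ S.P ∧ a ≠ 1) ∧ l.prod = x}

/-- The largest number of factors in an expression of a positive element `x` as a product of
nontrivial positive elements. It takes the junk value `0` if `x` is not positive. -/
noncomputable def len (x : G) : ℕ := sSup (S.factorLengths x)

theorem bddAbove_factorLengths {x : G} (hx : x ∈ S.P) : BddAbove (S.factorLengths x) := by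
  by_cases h : x = 1
  · refine ⟨0, ?_⟩
    rintro k ⟨l, rfl, hl, hp⟩
    cases l with
    | nil => simp
    | cons a t =>
      -- a nontrivial positive element has no positive inverse
      exfalso
      refine (hl a (by simp)).2 (S.eq_one_of_mem_of_inv_mem a (hl a (by simp)).1 ?_)
      rw [h, List.prod_cons] at hp
      rw [inv_eq_of_mul_eq_one_right hp]
      exact S.P.list_prod_mem fun b hb => (hl b (by simp [hb])).1
  · exact S.bddAbove_length x hx h

theorem exists_list_length_eq_len {x : G} (hx : x ∈ S.P) :
    ∃ l : List G, l.length = S.len x ∧ (∀ a ∈ l, a ∈ S.P ∧ a ≠ 1) ∧ l.prod = x := by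
  refine Nat.sSup_mem (s := S.factorLengths x) ?_ (S.bddAbove_factorLengths hx)
  by_cases h : x = 1
  · exact ⟨0, [], by simp [h]⟩
  · exact ⟨1, [x], by simp [h, hx]⟩

theorem length_le_len {l : List G} (hl : ∀ a ∈ l, a ∈ S.P ∧ a ≠ 1) :
    l.length ≤ S.len l.prod :=
  le_csSup (S.bddAbove_factorLengths (S.P.list_prod_mem fun a ha => (hl a ha).1))
    ⟨l, rfl, hl, rfl⟩

theorem len_lt_len_mul_left {d x : G} (hd : d ∈ S.P) (hd1 : d ≠ 1) (hx : x ∈ S.P) :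
    S.len x < S.len (d * x) := by
  obtain ⟨l, h1, h2, rfl⟩ := S.exists_list_length_eq_len hx
  have h := S.length_le_len (l := d :: l) (by simpa [hd, hd1] using h2)
  rw [List.prod_cons, List.length_cons] at h
  omega

theorem len_lt_len_mul_right {d x : G} (hd : d ∈ S.P) (hd1 : d ≠ 1) (hx : x ∈ S.P) :
    S.len x < S.len (x * d) := by
  obtain ⟨l, h1, h2, rfl⟩ := S.exists_list_length_eq_len hx
  have h := S.length_le_len (l := l ++ [d]) (by
    intro a ha
    rcases List.mem_append.1 ha with ha | ha
    · exact h2 a ha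
    · obtain rfl : a = d := by simpa using ha
      exact ⟨hd, hd1⟩)
  rw [List.prod_append, List.length_append, List.prod_singleton, List.length_singleton] at h
  omega

theorem len_conj_le {x : G} (hx : x ∈ S.P) : S.len (S.Δ⁻¹ * x * S.Δ) ≤ S.len x := by
  obtain ⟨l, h1, h2, h3⟩ := S.exists_list_length_eq_len ((S.conj_mem_iff x).2 hx)
  have h := S.length_le_len (l := l.map (MulAut.conj S.Δ)) (by
    intro a ha
    obtain ⟨b, hb, rfl⟩ := List.mem_map.1 ha
    refine ⟨?_, by simpa using (h2 b hb).2⟩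
    rw [← S.conj_mem_iff]
    simpa [mul_assoc] using (h2 b hb).1)
  rw [← map_list_prod, h3, List.length_map, h1] at h
  simpa [mul_assoc] using h

/-! ### Truncated cycling and sliding -/

/-- The element `g * ι_q(g⁻¹ y g)`, where `ι_q(w) = w Δ^{-q} ∧ Δ` is the initial factor with `q` in
place of `inf(w)`. -/
noncomputable def cycleStep (q : ℤ) (y g : G) : G :=
  S.meet (y * g * S.Δ ^ (-q)) (g * S.Δ)

/-- The element `g * 𝔭(g⁻¹ y g)`, where the preferred prefix is formed with `q` and `t` in place of
the infima of `g⁻¹ y g` and of its inverse. -/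
noncomputable def slideStep (q t : ℤ) (y g : G) : G :=
  S.meet (S.cycleStep q y g) (S.cycleStep t y⁻¹ g)

/-- Cycling with the exponent `q` in place of the infimum: conjugation of `y` by
`y Δ^{-q} ∧ Δ`. -/
noncomputable def truncCycling (q : ℤ) (y : G) : G :=
  (S.cycleStep q y 1)⁻¹ * y * S.cycleStep q y 1

/-- Cyclic sliding with the exponents `q` and `t` in place of the infima of `y` and `y⁻¹`. -/
noncomputable def truncSliding (q t : ℤ) (y : G) : G :=
  (S.slideStep q t y 1)⁻¹ * y * S.slideStep q t y 1

theorem cycleStep_eq_meet (q : ℤ) (y g : G) :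
    S.cycleStep q y g = S.meet (y * g * S.Δ ^ (-q)) (g * S.Δ) := rfl

theorem cycleStep_one_eq_meet (q : ℤ) (y : G) :
    S.cycleStep q y 1 = S.meet (y * S.Δ ^ (-q)) S.Δ := by
  rw [cycleStep, mul_one, one_mul]

theorem mul_cycleStep_conj (q : ℤ) (y c g : G) :
    c * S.cycleStep q (c⁻¹ * y * c) g = S.cycleStep q y (c * g) := by
  simp [cycleStep, mul_meet, mul_assoc]

theorem mul_slideStep_conj (q t : ℤ) (y c g : G) :
    c * S.slideStep q t (c⁻¹ * y * c) g = S.slideStep q t y (c * g) := by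
  have e : (c⁻¹ * y * c)⁻¹ = c⁻¹ * y⁻¹ * c := by group
  rw [slideStep, mul_meet, e, mul_cycleStep_conj, mul_cycleStep_conj, slideStep]

theorem cycleStep_le (q : ℤ) (y g : G) : S.le (S.cycleStep q y g) (g * S.Δ) :=
  S.meet_le_right _ _

theorem cycleStep_mono (q : ℤ) (y : G) {g h : G} (hgh : S.le g h) :
    S.le (S.cycleStep q y g) (S.cycleStep q y h) := by
  refine S.le_meet (S.le_trans (S.meet_le_left _ _) ?_) (S.le_trans (S.meet_le_right _ _) ?_)
  · rwa [le_mul_zpow_iff, mul_le_mul_left_iff]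
  · rwa [le_mul_Δ_iff]

theorem slideStep_mono (q t : ℤ) (y : G) {g h : G} (hgh : S.le g h) :
    S.le (S.slideStep q t y g) (S.slideStep q t y h) :=
  S.le_meet (S.le_trans (S.meet_le_left _ _) (S.cycleStep_mono q y hgh))
    (S.le_trans (S.meet_le_right _ _) (S.cycleStep_mono t y⁻¹ hgh))

theorem cycleStep_meet (q : ℤ) (y g h : G) :
    S.cycleStep q y (S.meet g h) = S.meet (S.cycleStep q y g) (S.cycleStep q y h) :=
  S.eq_of_forall_le_iff fun c => by
    simp only [cycleStep, mul_meet, meet_mul_zpow, meet_mul_Δ, le_meet_iff]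
    tauto

theorem cycleStep_mul_zpow (q : ℤ) (y g : G) (k : ℤ) :
    S.cycleStep q y (g * S.Δ ^ k) = S.cycleStep q y g * S.Δ ^ k := by
  rw [cycleStep, cycleStep, meet_mul_zpow]
  congr 1
  · simp only [mul_assoc, ← zpow_add, add_comm]
  · simp only [mul_assoc, ← zpow_one_add, ← zpow_add_one, add_comm]

theorem slideStep_mul_zpow (q t : ℤ) (y g : G) (k : ℤ) :
    S.slideStep q t y (g * S.Δ ^ k) = S.slideStep q t y g * S.Δ ^ k := by
  simp only [slideStep, cycleStep_mul_zpow, meet_mul_zpow]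

theorem cycleStep_mul_of_commute (q : ℤ) {y w : G} (h : Commute y w) (g : G) :
    S.cycleStep q y (w * g) = w * S.cycleStep q y g := by
  rw [cycleStep, cycleStep, mul_meet, ← mul_assoc y, h.eq]
  simp only [mul_assoc]

theorem cycleStep_cycleStep_comm (q t : ℤ) {y w : G} (h : Commute y w) (g : G) :
    S.cycleStep q y (S.cycleStep t w g) = S.cycleStep t w (S.cycleStep q y g) := by
  have e : ∀ a : G, a * S.Δ = a * S.Δ ^ (1 : ℤ) := fun a => by rw [zpow_one]
  rw [cycleStep_eq_meet S t w g, cycleStep_meet, e g, cycleStep_mul_zpow, cycleStep_mul_zpow,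
    cycleStep_mul_of_commute S q h, cycleStep_eq_meet S t w (S.cycleStep q y g), e]

theorem cycleStep_slideStep_comm (q t : ℤ) (y g : G) :
    S.cycleStep q y (S.slideStep q t y g) = S.slideStep q t y (S.cycleStep q y g) := by
  rw [slideStep, slideStep, cycleStep_meet,
    S.cycleStep_cycleStep_comm q t (Commute.refl y).inv_right]

theorem truncCycling_truncSliding_comm (q t : ℤ) (y : G) :
    S.truncCycling q (S.truncSliding q t y) = S.truncSliding q t (S.truncCycling q y) := by
  have h1 := S.mul_cycleStep_conj q y (S.slideStep q t y 1) 1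
  have h2 := S.mul_slideStep_conj q t y (S.cycleStep q y 1) 1
  rw [mul_one, cycleStep_slideStep_comm] at h1
  rw [mul_one, ← h1] at h2
  simp only [truncCycling, truncSliding]
  rw [← eq_inv_mul_iff_mul_eq] at h2
  rw [h2]
  group

/-! ### Conjugators that keep a lower bound on the infimum -/

theorem zpow_le_conj_iff (k : ℤ) (y g : G) :
    S.le (S.Δ ^ k) (g⁻¹ * y * g) ↔ S.le (g * S.Δ ^ k) (y * g) := by
  rw [mul_le_iff, mul_assoc]

theorem mul_zpow_le_meet {k : ℤ} {y g h : G} (hg : S.le (g * S.Δ ^ k) (y * g))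
    (hh : S.le (h * S.Δ ^ k) (y * h)) :
    S.le (S.meet g h * S.Δ ^ k) (y * S.meet g h) := by
  rw [meet_mul_zpow, mul_meet]
  exact S.le_meet (S.le_trans (S.meet_le_left _ _) hg) (S.le_trans (S.meet_le_right _ _) hh)

theorem mul_zpow_le_cycleStep {k : ℤ} {y w g : G} (q : ℤ) (h : Commute y w)
    (hg : S.le (g * S.Δ ^ k) (y * g)) :
    S.le (S.cycleStep q w g * S.Δ ^ k) (y * S.cycleStep q w g) := by
  have key : ∀ {g : G} (j : ℤ), S.le (g * S.Δ ^ k) (y * g) →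
      S.le (g * S.Δ ^ j * S.Δ ^ k) (y * (g * S.Δ ^ j)) := by
    intro g j hg
    rwa [mul_assoc, ← zpow_add, add_comm, zpow_add, ← mul_assoc, ← mul_assoc, le_mul_zpow_iff]
  refine S.mul_zpow_le_meet (key _ ?_) (by simpa using key 1 hg)
  rwa [← mul_assoc, h.eq, mul_assoc, mul_assoc, mul_le_mul_left_iff]

theorem zpow_le_inv_truncCycling {k : ℤ} {y : G} (q : ℤ) (hy : S.le (S.Δ ^ k) y⁻¹) :
    S.le (S.Δ ^ k) (S.truncCycling q y)⁻¹ := by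
  have e : (S.truncCycling q y)⁻¹ = (S.cycleStep q y 1)⁻¹ * y⁻¹ * S.cycleStep q y 1 := by
    rw [truncCycling]; group
  rw [e, zpow_le_conj_iff]
  exact S.mul_zpow_le_cycleStep q (Commute.refl y).inv_left (by simpa using hy)

theorem zpow_le_truncSliding_of_le {k : ℤ} {y : G} (q t : ℤ) (hy : S.le (S.Δ ^ k) y) :
    S.le (S.Δ ^ k) (S.truncSliding q t y) := by
  rw [truncSliding, zpow_le_conj_iff]
  have hy' : S.le (1 * S.Δ ^ k) (y * 1) := by simpa using hy
  exact S.mul_zpow_le_meet (S.mul_zpow_le_cycleStep q (Commute.refl y) hy')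
    (S.mul_zpow_le_cycleStep t (Commute.refl y).inv_right hy')

/-! ### Raising the infimum -/

/-- If cycling raises the infimum above `q`, then so does cyclic sliding. -/
theorem zpow_le_truncSliding {q t : ℤ} {y : G} (hy : S.le (S.Δ ^ t) y⁻¹)
    (hc : S.le (S.Δ ^ (q + 1)) (S.truncCycling q y)) :
    S.le (S.Δ ^ (q + 1)) (S.truncSliding q t y) := by
  rw [truncCycling, zpow_le_conj_iff] at hc
  rw [truncSliding, zpow_le_conj_iff]
  set i := S.cycleStep q y 1 with hi
  set u := S.slideStep q t y 1 with hu
  have hui : S.le u i := S.meet_le_left _ _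
  have huv : S.le u (y⁻¹ * S.Δ ^ (-t)) := by
    refine S.le_trans (S.meet_le_right _ _) (S.le_trans (S.meet_le_left _ _) ?_)
    rw [mul_one]
    exact S.le_refl _
  have hiΔ : S.le i S.Δ := by simpa using S.cycleStep_le q y 1
  have heq : u = S.meet i (y⁻¹ * S.Δ ^ (-t)) := by
    refine S.le_antisymm (S.le_meet hui huv) (S.le_meet (S.meet_le_left _ _) (S.le_meet ?_ ?_))
    · rw [mul_one]
      exact S.meet_le_right _ _
    · rw [one_mul]
      exact S.le_trans (S.meet_le_left _ _) hiΔ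
  -- It suffices to bound `u` by `Δ ^ (L - 1)`, where `L = -t - q` bounds the canonical length.
  have hub : S.le u (S.Δ ^ (-t - q - 1)) := by
    rcases le_or_gt 2 (-t - q) with hL | hL
    · refine S.le_trans hui (S.le_trans hiΔ ?_)
      simpa using S.zpow_le_zpow (p := 1) (q := -t - q - 1) (by omega)
    · -- Now `y Δ^{-q}` is simple, so that cycling only conjugates `y` by a power of `Δ`.
      have hyΔ : S.le (y * S.Δ ^ (-q)) S.Δ := by
        have h1 : S.le y (S.Δ ^ (-t)) := by
          rw [← S.mul_le_mul_left_iff y⁻¹, ← S.le_mul_zpow_iff _ _ t]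
          simpa [mul_assoc] using hy
        have h2 := (S.le_mul_zpow_iff _ _ (-q)).2 h1
        rw [← zpow_add] at h2
        refine S.le_trans h2 ?_
        simpa using S.zpow_le_zpow (p := -t + -q) (q := 1) (by omega)
      have hiy : i = y * S.Δ ^ (-q) := by
        rw [hi, cycleStep_one_eq_meet]
        exact S.le_antisymm (S.meet_le_left _ _) (S.le_meet (S.le_refl _) hyΔ)
      have hq : S.le (S.Δ ^ (q + 1)) y := by
        rw [hiy, mul_assoc, mul_le_mul_left_iff, ← zpow_add, add_comm, zpow_add,
          le_mul_zpow_iff] at hc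
        exact hc
      refine S.le_trans huv ?_
      have h3 : S.le y⁻¹ (S.Δ ^ (-(q + 1))) := by
        rw [← S.mul_le_mul_left_iff y, ← S.le_mul_zpow_iff _ _ (q + 1)]
        simpa only [mul_assoc, inv_mul_cancel_left, mul_inv_cancel_left, mul_inv_cancel, one_mul,
          ← zpow_add, neg_add_cancel, zpow_zero, mul_one] using hq
      have h4 := (S.le_mul_zpow_iff _ _ (-t)).2 h3
      rw [← zpow_add] at h4
      convert h4 using 2
      ring
  have hyu : y * u = S.meet (y * i) (S.Δ ^ (-t)) := by
    rw [heq, mul_meet]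
    simp
  rw [hyu]
  refine S.le_meet (S.le_trans ((S.le_mul_zpow_iff _ _ _).2 hui) hc) ?_
  have h5 := (S.le_mul_zpow_iff _ _ (q + 1)).2 hub
  rw [← zpow_add] at h5
  convert h5 using 2
  ring

/-- Iterated cycling raises the infimum above `q`, if some conjugate of `y` has a larger one. The
conjugator `c` from such an element `z` to `y` can be taken positive; it then gets shorter
with each step. -/
theorem exists_iterate_truncCycling {q : ℤ} {z c : G} (hc : S.le 1 c)
    (hz : S.le (S.Δ ^ (q + 1)) z) :
    ∃ n, S.le (S.Δ ^ (q + 1)) ((S.truncCycling q)^[n] (c⁻¹ * z * c)) := by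
  induction hn : S.len c using Nat.strong_induction_on generalizing z c with
  | _ n ih =>
    subst hn
    set y := c⁻¹ * z * c with hy
    set i := S.cycleStep q y 1 with hi
    have hiΔ : S.le i S.Δ := by simpa using S.cycleStep_le q y 1
    by_cases hieq : i = S.Δ
    · refine ⟨0, ?_⟩
      have h1 : S.le S.Δ (y * S.Δ ^ (-q)) := by
        conv_lhs => rw [← hieq, hi, cycleStep_one_eq_meet]
        exact S.meet_le_left _ _
      rw [← S.le_mul_zpow_iff _ _ q] at h1
      simpa [mul_assoc, ← zpow_one_add, add_comm] using h1
    have hzΔ : S.cycleStep q z 1 = S.Δ := by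
      refine S.le_antisymm (by simpa using S.cycleStep_le q z 1) (S.le_meet ?_ ?_)
      · rw [mul_one, ← S.le_mul_zpow_iff _ _ q]
        simpa [mul_assoc, ← zpow_one_add, add_comm] using hz
      · rw [one_mul]; exact S.le_refl _
    have hΔc : S.le S.Δ (c * i) := by
      have h := S.cycleStep_mono q z hc
      have h2 := S.mul_cycleStep_conj q z c 1
      rw [mul_one] at h2
      rwa [hzΔ, ← h2] at h
    have hcP : c ∈ S.P := (S.one_le_iff c).1 hc
    have hc' : S.Δ⁻¹ * (c * i) ∈ S.P := hΔc
    have hlt : S.len (S.Δ⁻¹ * (c * i)) < S.len c := by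
      refine lt_of_lt_of_le ?_ (S.len_conj_le hcP)
      have e : S.Δ⁻¹ * c * S.Δ = S.Δ⁻¹ * (c * i) * (i⁻¹ * S.Δ) := by group
      rw [e]
      exact S.len_lt_len_mul_right hiΔ (fun h => hieq (inv_mul_eq_one.1 h)) hc'
    have hz' : S.le (S.Δ ^ (q + 1)) (S.Δ⁻¹ * z * S.Δ) := by
      rw [zpow_le_conj_iff, ← zpow_one_add, add_comm, zpow_add_one, le_mul_Δ_iff]
      exact hz
    obtain ⟨m, hm⟩ := ih _ hlt ((S.one_le_iff _).2 hc') hz' rfl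
    refine ⟨m + 1, ?_⟩
    rw [Function.iterate_succ_apply]
    convert hm using 2
    rw [truncCycling, ← hi, hy]
    group

theorem zpow_le_iff_le_infimum (hΔ : S.Δ ≠ 1) (k : ℤ) (y : G) :
    S.le (S.Δ ^ k) y ↔ k ≤ S.infimum y := by
  obtain ⟨l, hl⟩ := S.infimum_spec y
  have h := hl.isGreatest hΔ
  exact ⟨fun hk => h.2 hk, fun hk => S.le_trans (S.zpow_le_zpow hk) h.1⟩

theorem zpow_infimum_le (y : G) : S.le (S.Δ ^ S.infimum y) y := by
  obtain ⟨l, hl, hs, -⟩ := S.infimum_spec y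
  conv_rhs => rw [hl]
  exact S.le_prod_of_forall _ l fun b hb => (hs b hb).1

theorem preferredPrefix_eq (y : G) :
    S.preferredPrefix y = S.slideStep (S.infimum y) (S.infimum y⁻¹) y 1 := by
  simp [preferredPrefix, initialFactor, slideStep, cycleStep]

theorem cyclicSliding_eq (y : G) :
    S.cyclicSliding y = S.truncSliding (S.infimum y) (S.infimum y⁻¹) y := by
  rw [cyclicSliding, preferredPrefix_eq, truncSliding]

theorem zpow_le_cyclicSliding {k : ℤ} {y : G} (hy : S.le (S.Δ ^ k) y) :
    S.le (S.Δ ^ k) (S.cyclicSliding y) := by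
  rw [cyclicSliding_eq]
  exact S.zpow_le_truncSliding_of_le _ _ hy

theorem zpow_le_iterate_cyclicSliding {k : ℤ} {y : G} (hy : S.le (S.Δ ^ k) y) (n : ℕ) :
    S.le (S.Δ ^ k) (S.cyclicSliding^[n] y) := by
  induction n with
  | zero => exact hy
  | succ n ih =>
    rw [Function.iterate_succ_apply']
    exact S.zpow_le_cyclicSliding ih

theorem isConj_iterate_cyclicSliding (y : G) (n : ℕ) : IsConj y (S.cyclicSliding^[n] y) := by
  induction n with
  | zero => exact IsConj.refl y
  | succ n ih =>
    rw [Function.iterate_succ_apply']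
    refine ih.trans (isConj_iff.2 ⟨(S.preferredPrefix (S.cyclicSliding^[n] y))⁻¹, ?_⟩)
    rw [inv_inv, cyclicSliding]

theorem exists_iterate_cyclicSliding_of_truncCycling (hΔ : S.Δ ≠ 1) {q : ℤ} (n : ℕ) {y : G}
    (hy : S.le (S.Δ ^ q) y) (hn : S.le (S.Δ ^ (q + 1)) ((S.truncCycling q)^[n] y)) :
    ∃ m, S.le (S.Δ ^ (q + 1)) (S.cyclicSliding^[m] y) := by
  induction n generalizing y with
  | zero => exact ⟨0, hn⟩
  | succ n ih =>
    by_cases h1 : S.le (S.Δ ^ (q + 1)) y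
    · exact ⟨0, h1⟩
    have hq : S.infimum y = q := by
      rw [zpow_le_iff_le_infimum S hΔ] at hy h1
      omega
    have hs := S.cyclicSliding_eq y
    rw [hq] at hs
    have hinv : ∀ j, S.le (S.Δ ^ S.infimum y⁻¹) ((S.truncCycling q)^[j] y)⁻¹ := by
      intro j
      induction j with
      | zero => exact S.zpow_infimum_le y⁻¹
      | succ j ihj =>
        rw [Function.iterate_succ_apply']
        exact S.zpow_le_inv_truncCycling q ihj
    rw [Function.iterate_succ_apply'] at hn
    have h2 := S.zpow_le_truncSliding (hinv n) hn
    have hcomm : Function.Commute (S.truncSliding q (S.infimum y⁻¹)) (S.truncCycling q) :=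
      fun w => (S.truncCycling_truncSliding_comm q (S.infimum y⁻¹) w).symm
    rw [(hcomm.iterate_right n).eq y, ← hs] at h2
    obtain ⟨m, hm⟩ := ih (S.zpow_le_cyclicSliding hy) h2
    exact ⟨m + 1, by rwa [Function.iterate_succ_apply]⟩

theorem exists_iterate_zpow_add_one_le (hΔ : S.Δ ≠ 1) {q : ℤ} {y z : G} (hyz : IsConj y z)
    (hy : S.le (S.Δ ^ q) y) (hz : S.le (S.Δ ^ (q + 1)) z) :
    ∃ m, S.le (S.Δ ^ (q + 1)) (S.cyclicSliding^[m] y) := by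
  obtain ⟨h, hh⟩ := isConj_iff.1 hyz
  obtain ⟨n, hn, -⟩ := S.exists_bounds h
  -- A left multiple of the conjugator by a power of `Δ` is positive.
  have hc : S.le 1 (S.Δ ^ n * h) := by
    rw [← S.mul_le_mul_left_iff (S.Δ ^ (-(n : ℤ)))]
    simpa [← mul_assoc] using hn
  have hz' : S.le (S.Δ ^ (q + 1)) ((S.Δ ^ (-(n : ℤ)))⁻¹ * z * S.Δ ^ (-(n : ℤ))) := by
    rw [zpow_le_conj_iff, ← zpow_add, add_comm, zpow_add, le_mul_zpow_iff]
    exact hz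
  obtain ⟨j, hj⟩ := S.exists_iterate_truncCycling hc hz'
  refine S.exists_iterate_cyclicSliding_of_truncCycling hΔ j hy ?_
  convert hj using 2
  rw [← hh, zpow_neg, zpow_natCast]
  group

/-- Iterated cyclic sliding reaches any lower bound on the infimum that holds somewhere in the
conjugacy class. -/
theorem exists_iterate_cyclicSliding (hΔ : S.Δ ≠ 1) {k : ℤ} {y z : G} (hyz : IsConj y z)
    (hz : S.le (S.Δ ^ k) z) : ∃ m, S.le (S.Δ ^ k) (S.cyclicSliding^[m] y) := by
  have key : ∀ j : ℕ, S.le (S.Δ ^ (S.infimum y + j)) z →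
      ∃ m, S.le (S.Δ ^ (S.infimum y + j)) (S.cyclicSliding^[m] y) := by
    intro j
    induction j with
    | zero => exact fun _ => ⟨0, by simpa using S.zpow_infimum_le y⟩
    | succ j ih =>
      intro hj
      obtain ⟨m, hm⟩ := ih (S.le_trans (S.zpow_le_zpow (by push_cast; omega)) hj)
      obtain ⟨m', hm'⟩ := S.exists_iterate_zpow_add_one_le hΔ
        ((S.isConj_iterate_cyclicSliding y m).symm.trans hyz) hm
        (by simpa [add_assoc] using hj)
      refine ⟨m' + m, ?_⟩
      rw [Function.iterate_add_apply]
      simpa [add_assoc] using hm'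
  rcases le_total k (S.infimum y) with h | h
  · exact ⟨0, S.le_trans (S.zpow_le_zpow h) (S.zpow_infimum_le y)⟩
  · obtain ⟨j, rfl⟩ := Int.le.dest h
    exact key j hz

theorem cyclicSliding_inv (y : G) : S.cyclicSliding y⁻¹ = (S.cyclicSliding y)⁻¹ := by
  have e : S.preferredPrefix y⁻¹ = S.preferredPrefix y := by
    rw [preferredPrefix, preferredPrefix, inv_inv, meet_comm]
  rw [cyclicSliding, cyclicSliding, e]
  group

theorem iterate_cyclicSliding_inv (y : G) (n : ℕ) :
    S.cyclicSliding^[n] y⁻¹ = (S.cyclicSliding^[n] y)⁻¹ :=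
  Function.Semiconj.iterate_right (f := Inv.inv) (ga := S.cyclicSliding) (gb := S.cyclicSliding)
    (fun w => (S.cyclicSliding_inv w).symm) n y |>.symm

/-! ### Rigid elements -/

variable {S}

theorem IsRigid.cyclicSliding_eq_self {z : G} (hz : S.IsRigid z) : S.cyclicSliding z = z := by
  rw [cyclicSliding, show S.preferredPrefix z = 1 from hz]
  simp

theorem IsRigid.zpow_le_of_isConj (hΔ : S.Δ ≠ 1) {k : ℤ} {y z : G} (hz : S.IsRigid z)
    (hyz : IsConj y z) (hy : S.le (S.Δ ^ k) y) : S.le (S.Δ ^ k) z := by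
  obtain ⟨m, hm⟩ := S.exists_iterate_cyclicSliding hΔ hyz.symm hy
  rwa [Function.iterate_fixed hz.cyclicSliding_eq_self] at hm

theorem isConj_inv {y z : G} (h : IsConj y z) : IsConj y⁻¹ z⁻¹ := by
  obtain ⟨c, rfl⟩ := isConj_iff.1 h
  exact isConj_iff.2 ⟨c, by group⟩

theorem IsRigid.inv {z : G} (hz : S.IsRigid z) : S.IsRigid z⁻¹ := by
  rw [IsRigid, preferredPrefix, inv_inv, meet_comm]
  exact hz

/-- Let `y` have the infimum and the supremum of its rigid conjugate `z`. The equation satisfied by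
`a` says that `a⁻¹ y a` has trivial truncated preferred prefix; then `𝔭(y) ≼ a` whenever `a`
is positive. -/
theorem exists_iterate_isRigid_of_slideStep_eq (hΔ : S.Δ ≠ 1) {z : G} (hz : S.IsRigid z)
    {y a : G} (ha : S.le 1 a) (hyz : IsConj y z)
    (hy : S.le (S.Δ ^ S.infimum z) y) (hy' : S.le (S.Δ ^ S.infimum z⁻¹) y⁻¹)
    (hs : S.slideStep (S.infimum z) (S.infimum z⁻¹) y a = a) :
    ∃ n, S.IsRigid (S.cyclicSliding^[n] y) := by
  induction hn : S.len a using Nat.strong_induction_on generalizing y a with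
  | _ n ih =>
    subst hn
    have h1 : S.infimum y = S.infimum z :=
      _root_.le_antisymm ((S.zpow_le_iff_le_infimum hΔ _ _).1
        (hz.zpow_le_of_isConj hΔ hyz (S.zpow_infimum_le y)))
        ((S.zpow_le_iff_le_infimum hΔ _ _).1 hy)
    have h2 : S.infimum y⁻¹ = S.infimum z⁻¹ :=
      _root_.le_antisymm ((S.zpow_le_iff_le_infimum hΔ _ _).1
        (hz.inv.zpow_le_of_isConj hΔ (isConj_inv hyz) (S.zpow_infimum_le y⁻¹)))
        ((S.zpow_le_iff_le_infimum hΔ _ _).1 hy')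
    by_cases hr : S.IsRigid y
    · exact ⟨0, hr⟩
    have hp := S.preferredPrefix_eq y
    rw [h1, h2] at hp
    set u := S.preferredPrefix y with hu
    have hsl : S.cyclicSliding y = u⁻¹ * y * u := rfl
    have hu1 : S.le 1 u := by
      have h : ∀ w : G, S.le 1 (S.initialFactor w) := by
        intro w
        refine S.le_meet ?_ S.one_le_Δ
        rw [← S.le_mul_zpow_iff _ _ (S.infimum w)]
        simpa [mul_assoc] using S.zpow_infimum_le w
      exact S.le_meet (h y) (h y⁻¹)
    have hua : S.le u a := by
      rw [hp]
      have h := S.slideStep_mono (S.infimum z) (S.infimum z⁻¹) y ha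
      rwa [hs] at h
    have hlt : S.len (u⁻¹ * a) < S.len a := by
      have h := S.len_lt_len_mul_left ((S.one_le_iff u).1 hu1) hr (x := u⁻¹ * a) hua
      rwa [mul_inv_cancel_left] at h
    obtain ⟨m, hm⟩ := ih _ hlt (y := S.cyclicSliding y) (a := u⁻¹ * a)
      ((S.one_le_iff _).2 hua)
      ((S.isConj_iterate_cyclicSliding y 1).symm.trans hyz) (S.zpow_le_cyclicSliding hy)
      (by rw [← cyclicSliding_inv]; exact S.zpow_le_cyclicSliding hy')
      (by
        rw [hsl, ← mul_right_inj u, mul_slideStep_conj, mul_inv_cancel_left, hs]) rfl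
    exact ⟨m + 1, by rwa [Function.iterate_succ_apply]⟩

/-- Every conjugate of a rigid element becomes rigid after finitely many cyclic slidings. -/
theorem exists_iterate_isRigid (hΔ : S.Δ ≠ 1) {y z : G} (hz : S.IsRigid z) (hyz : IsConj y z) :
    ∃ n, S.IsRigid (S.cyclicSliding^[n] y) := by
  obtain ⟨n₁, h₁⟩ := S.exists_iterate_cyclicSliding hΔ hyz (S.zpow_infimum_le z)
  set y₁ := S.cyclicSliding^[n₁] y with hy₁
  have hc₁ : IsConj y₁ z := (S.isConj_iterate_cyclicSliding y n₁).symm.trans hyz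
  obtain ⟨n₂, h₂⟩ := S.exists_iterate_cyclicSliding hΔ (isConj_inv hc₁) (S.zpow_infimum_le z⁻¹)
  rw [iterate_cyclicSliding_inv] at h₂
  have h₁' := S.zpow_le_iterate_cyclicSliding h₁ n₂
  set y₂ := S.cyclicSliding^[n₂] y₁ with hy₂
  have hc₂ : IsConj y₂ z := (S.isConj_iterate_cyclicSliding y₁ n₂).symm.trans hc₁
  obtain ⟨c, hc⟩ := isConj_iff.1 hc₂.symm
  obtain ⟨k, hk, -⟩ := S.exists_bounds c
  have hpos : S.le 1 (c * S.Δ ^ (k : ℤ)) := by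
    rw [← S.le_mul_zpow_iff _ _ (-(k : ℤ))]
    simpa [mul_assoc] using hk
  have hs : S.slideStep (S.infimum z) (S.infimum z⁻¹) y₂ (c * S.Δ ^ (k : ℤ)) =
      c * S.Δ ^ (k : ℤ) := by
    have h := S.mul_slideStep_conj (S.infimum z) (S.infimum z⁻¹) y₂ c 1
    have e : c⁻¹ * y₂ * c = z := by rw [← hc]; group
    rw [e, ← preferredPrefix_eq, show S.preferredPrefix z = 1 from hz, mul_one] at h
    rw [slideStep_mul_zpow, ← h]
  obtain ⟨n₃, h₃⟩ := exists_iterate_isRigid_of_slideStep_eq hΔ hz hpos hc₂ h₁' h₂ hs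
  refine ⟨n₃ + (n₂ + n₁), ?_⟩
  rwa [Function.iterate_add_apply, Function.iterate_add_apply]

theorem isRigid_of_Δ_eq_one (hΔ : S.Δ = 1) (y : G) : S.IsRigid y := by
  have h : ∀ w : G, w = 1 := by
    intro w
    obtain ⟨n, h1, h2⟩ := S.exists_bounds w
    simp only [hΔ, one_zpow, one_pow] at h1 h2
    exact S.le_antisymm h2 h1
  exact h _

end GarsideStructure

theorem theoremT {G : Type*} [Group G] (S : GarsideStructure G) (hS : S.FiniteType)
    (x : G) (hx : ∃ z : G, IsConj x z ∧ S.IsRigid z) :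
    S.slidingCircuits x = {y : G | IsConj x y ∧ S.IsRigid y} := by
  ext y
  constructor
  · rintro ⟨hxy, m, hm, hmy⟩
    refine ⟨hxy, ?_⟩
    by_cases hΔ : S.Δ = 1
    · exact GarsideStructure.isRigid_of_Δ_eq_one hΔ y
    obtain ⟨z, hxz, hz⟩ := hx
    obtain ⟨n, hn⟩ := GarsideStructure.exists_iterate_isRigid hΔ hz (hxy.symm.trans hxz)
    -- The orbit of `y` is eventually constant and periodic, so `y` itself is rigid.
    have hper : S.cyclicSliding^[m * n] y = y := by
      rw [Function.iterate_mul]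
      exact Function.iterate_fixed hmy n
    obtain ⟨d, hd⟩ := Nat.exists_eq_add_of_le (Nat.le_mul_of_pos_left n hm)
    rw [hd, add_comm, Function.iterate_add_apply,
      Function.iterate_fixed hn.cyclicSliding_eq_self] at hper
    rwa [hper] at hn
  · rintro ⟨hxy, hy⟩
    exact ⟨hxy, 1, le_rfl, hy.cyclicSliding_eq_self⟩
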